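/- **Setting.** Let $\mathcal G$ be a causal diagram on a finite vertex set $\mathbf V$ (an acyclic set of directed edges together with bidirected edges) and let $Y\in\mathbf V$ be the reward variable. $\mathcal G_{\overline{\mathbf X}}$ (resp. $\mathcal G_{\underline{\mathbf X}}$) is $\mathcal G$ without the (directed and bidirected) edges into $\mathbf X$ (resp. without the directed edges out of $\mathbf X$); $\mathcal G[\mathbf A]$ is the induced subgraph; $\mathrm{An}$, $\mathrm{De}$ are inclusive ancestors and descendants, $\mathrm{Pa}$ parents, and $\mathrm{CC}(\mathbf T)$ the set of vertices joined to $\mathbf T$ by bidirected paths, including $\mathbf T$. With $\mathcal H=\mathcal G[\mathrm{An}(Y)_{\mathcal G}]$, $\mathsf{MUCT}(\mathcal G,Y)$ is the smallest set $\mathbf T$ of vertices of $\mathcal H$ with $Y\in\mathbf T$, $\mathrm{De}(\mathbf T)_{\mathcal H}=\mathbf T$, $\mathrm{CC}(\mathbf T)_{\mathcal H}=\mathbf T$, and $\mathsf{IB}(\mathcal G,Y)=\mathrm{Pa}(\mathbf T)_{\mathcal G}\setminus\mathbf T$ for this $\mathbf T$. A model conforming to $\mathcal G$ is a structural causal model with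 finite domains, real-valued reward and independent exogenous variables (finitely many, with arbitrary distributions) in which the function of a variable takes its parents in $\mathcal G$ and some exogenous variables as arguments, two variables sharing an exogenous argument only if they are joined by a bidirected edge. Write $\mathbb E_{P_{\mathbf x}}Y$ for the expected reward under $do(\mathbf X=\mathbf x)$. For sets $\mathbf X,\mathbf W\subseteq\mathbf V\setminus\{Y\}$: * $\mathbf X$ and $\mathbf W$ are *equivalent* if $\mathbb E_{P_{\mathbf v[\mathbf X]}}Y=\mathbb E_{P_{\mathbf v[\mathbf W]}}Y$ for every model conforming to $\mathcal G$ and every joint value $\mathbf v$ of $\mathbf V$, where $\mathbf v[\mathbf X]$ is the restriction of $\mathbf v$ to $\mathbf X$; * $\mathbf X$ is an *MIS* if no proper subset of it is equivalent to it; * $\mathbf X$ is a *POMIS* if it is an MIS and in some model conforming to $\mathcal G$, $\max_{\mathbf x}\mathbb E_{P_{\mathbf x}}Y>\max_{\mathbf w}\mathbb E_{P_{\mathbf w}}Y$ for every other MIS $\mathbf W$; * $\mathbf X$ is a *POIS* if in some model conforming to $\mathcal G$, $\max_{\mathbf x}\mathbb E_{P_{\mathbf x}}Y>\max_{\mathbf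 w}\mathbb E_{P_{\mathbf w}}Y$ for every $\mathbf W$ not equivalent to $\mathbf X$. **Causal bounds.** Let a target environment $\pi^*$ and source environments $\pi^1,\dots,\pi^n$ be given by models conforming to $\mathcal G$ (with common domains and exogenous arguments), such that the mechanism of each variable outside $\Delta^i\subseteq\mathbf V$ (its function and the distribution of its exogenous arguments) is the same in $\pi^i$ and $\pi^*$; this is the collective selection diagram $\mathcal G^{\boldsymbol\Delta}$. Let $\mathbb Z^i$ be the collection of sets $\mathbf Z$ on which experiments (yielding $P^i_{\mathbf z}$ for all $\mathbf z$) are available in $\pi^i$. Put $Q^i[\mathbf C](\mathbf v)=P^i_{\mathbf v\setminus\mathbf c}(\mathbf c)$. For a set $\mathbf X$ let $\mathbf Y^+=\mathrm{An}(Y)_{\mathcal G_{\underline{\mathbf X}}}$ and let $\mathbf C_1,\dots,\mathbf C_m$ be the maximal c-components (classes of vertices connected by bidirected paths) of $\mathcal G[\mathbf Y^+]$. For each $q$ choose a source $i_q$ with $\mathbf C_q\cap\Delta^{i_q}=\emptyset$ and a set $\mathbf C_q'\supseteq\mathbf C_q$ such that $Q^{i_q}[\mathbf C'_q]$ is computable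 from some $Q^{i_q}[\mathbf V\setminus\mathbf Z]$, $\mathbf Z\in\mathbb Z^{i_q}$; that is, $\mathbf C'_q$ arises from $\mathbf V\setminus\mathbf Z$ by repeatedly passing from a set $\mathbf A$ to an ancestral set or a maximal c-component of $\mathcal G[\mathbf A]$. Set $$L_q=U_q=\sum_{\mathbf c_q'\setminus\mathbf c_q}Q^{i_q}[\mathbf C_q']\quad\text{if }\mathrm{An}(\mathbf C_q)_{\mathcal G[\mathbf C_q']}=\mathbf C_q,$$ $$L_q=Q^{i_q}[\mathbf C_q'],\qquad U_q=Q^{i_q}[\mathbf C_q']+1-\sum_{\mathbf c_q}Q^{i_q}[\mathbf C_q']\quad\text{otherwise.}$$ The causal bounds are the following functions of $\mathbf v$ (variables outside $\mathbf Y^+$ take their values in $\mathbf v$), where the maximum and minimum run over all such choices and are $0$ and $\infty$ if there is none: $$\ell_{\mathbf X}(\mathbf v)=\max\Bigl\{0,\ \max\sum_{\mathbf y^+}y\prod_{q=1}^mL_q\Bigr\},\qquad u_{\mathbf X}(\mathbf v)=\min\sum_y y\,\min\Bigl\{1,\sum_{\mathbf y^+\setminus y}\prod_{q=1}^mU_q\Bigr\}.$$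 The bounds $\ell_{\mathbf x},u_{\mathbf x}$ of the single action $do(\mathbf X=\mathbf x)$ are the maximum of $\ell_{\mathbf X}(\mathbf v)$ and the minimum of $u_{\mathbf X}(\mathbf v)$ over all $\mathbf v$ that agree with $\mathbf x$ on $\mathrm{Pa}(\mathbf Y^+)_{\mathcal G}\setminus\mathbf Y^+$ (a subset of $\mathbf X$). **Statement.** Let $\mathbf R\subseteq\mathbf V\setminus\{Y\}$ be a POIS with respect to $\langle\mathcal G,Y\rangle$ and $\mathbf R^\dagger=\mathsf{IB}(\mathcal G_{\overline{\mathbf R}},Y)$. Then 1. $\mathbf R^\dagger$ is a POMIS with respect to $\langle\mathcal G,Y\rangle$, and $\mathbf R^\dagger\subseteq\mathbf R$; 2. $\mathbf R$ and $\mathbf R^\dagger$ are equivalent: $\mathbb E_{P_{\mathbf v[\mathbf R]}}Y=\mathbb E_{P_{\mathbf v[\mathbf R^\dagger]}}Y$ for every model conforming to $\mathcal G$ and every $\mathbf v$; 3. they share the causal bounds: for all environments and experiments as above, $\ell_{\mathbf R}=\ell_{\mathbf R^\dagger}$ and $u_{\mathbf R}=u_{\mathbf R^\dagger}$ as functions of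 $\mathbf v$, and $\ell_{\mathbf r}=\ell_{\mathbf r[\mathbf R^\dagger]}$ and $u_{\mathbf r}=u_{\mathbf r[\mathbf R^\dagger]}$ for every action $\mathbf r$ on $\mathbf R$. -/

import Mathlib

open MeasureTheory

noncomputable section

/-- A causal diagram (acyclic directed mixed graph) over the variables `V`: directed edges `dir`,
bidirected edges `bi` (unobserved confounding). -/
structure CausalDiagram (V : Type*) where
  dir : V → V → Prop
  bi : SimpleGraph V
  acyclic : ∀ i, ¬ Relation.TransGen dir i i

namespace CausalDiagram

variable {V : Type*}

/-- The subgraph `G[A]`. The vertex type is kept; vertices outside `A` become isolated. -/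
def induce (G : CausalDiagram V) (A : Set V) : CausalDiagram V where
  dir i j := G.dir i j ∧ i ∈ A ∧ j ∈ A
  bi :=
    { Adj := fun i j => G.bi.Adj i j ∧ i ∈ A ∧ j ∈ A
      symm := ⟨fun _ _ h => ⟨h.1.symm, h.2.2, h.2.1⟩⟩
      loopless := ⟨fun _ h => G.bi.irrefl h.1⟩ }
  acyclic i h := G.acyclic i (Relation.TransGen.mono (p := G.dir) (fun _ _ h => h.1) i i h)

/-- `G` with all edges into `X` removed (directed edges into `X` and bidirected edges at `X`). -/
def cutIn (G : CausalDiagram V) (X : Set V) : CausalDiagram V where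
  dir i j := G.dir i j ∧ j ∉ X
  bi :=
    { Adj := fun i j => G.bi.Adj i j ∧ i ∉ X ∧ j ∉ X
      symm := ⟨fun _ _ h => ⟨h.1.symm, h.2.2, h.2.1⟩⟩
      loopless := ⟨fun _ h => G.bi.irrefl h.1⟩ }
  acyclic i h := G.acyclic i (Relation.TransGen.mono (p := G.dir) (fun _ _ h => h.1) i i h)

/-- `G` with all directed edges out of `X` removed. -/
def cutOut (G : CausalDiagram V) (X : Set V) : CausalDiagram V where
  dir i j := G.dir i j ∧ i ∉ X
  bi := G.bi
  acyclic i h := G.acyclic i (Relation.TransGen.mono (p := G.dir) (fun _ _ h => h.1) i i h)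

/-- Ancestors of `S`, including `S`. -/
def An (G : CausalDiagram V) (S : Set V) : Set V :=
  {i | ∃ s ∈ S, Relation.ReflTransGen G.dir i s}

/-- Descendants of `S`, including `S`. -/
def De (G : CausalDiagram V) (S : Set V) : Set V :=
  {i | ∃ s ∈ S, Relation.ReflTransGen G.dir s i}

/-- Parents of members of `S`. -/
def Pa (G : CausalDiagram V) (S : Set V) : Set V := {i | ∃ s ∈ S, G.dir i s}

/-- Vertices joined to `S` by a path of bidirected edges, including `S`. -/
def CC (G : CausalDiagram V) (S : Set V) : Set V := {i | ∃ s ∈ S, G.bi.Reachable s i}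

/-- The maximal c-components of `G[A]`. -/
def components (G : CausalDiagram V) (A : Set V) : Set (Set V) :=
  {C | ∃ i ∈ A, C = (G.induce A).CC {i}}

/-- `T` is a UC-territory on `G` with respect to `Y`: with `H = G[An(Y)]`, `T` is a set of vertices
of `H` that contains `Y` and is closed under descendants and bidirected paths in `H`. -/
def IsUCTerritory (G : CausalDiagram V) (Y : V) (T : Set V) : Prop :=
  T ⊆ G.An {Y} ∧ Y ∈ T ∧ (G.induce (G.An {Y})).De T = T ∧ (G.induce (G.An {Y})).CC T = T

/-- The minimal UC-territory, see `muct_isLeast`. -/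
def muct (G : CausalDiagram V) (Y : V) : Set V := ⋂₀ {T | G.IsUCTerritory Y T}

/-- The interventional border. -/
def ib (G : CausalDiagram V) (Y : V) : Set V := G.Pa (G.muct Y) \ G.muct Y

theorem induce_reflTransGen_mem (G : CausalDiagram V) (A : Set V) {i j : V} (hi : i ∈ A)
    (h : Relation.ReflTransGen (G.induce A).dir i j) : j ∈ A := by
  induction h with
  | refl => exact hi
  | tail _ h _ => exact h.2.2

theorem induce_reachable_mem (G : CausalDiagram V) (A : Set V) {i j : V} (hi : i ∈ A)
    (h : (G.induce A).bi.Reachable i j) : j ∈ A := by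
  rw [SimpleGraph.reachable_iff_reflTransGen] at h
  induction h with
  | refl => exact hi
  | tail _ h _ => exact h.2.2

theorem isUCTerritory_an (G : CausalDiagram V) (Y : V) : G.IsUCTerritory Y (G.An {Y}) := by
  refine ⟨subset_rfl, ⟨Y, rfl, .refl⟩, ?_, ?_⟩
  · refine Set.Subset.antisymm ?_ fun i hi => ⟨i, hi, .refl⟩
    rintro i ⟨s, hs, h⟩
    exact G.induce_reflTransGen_mem _ hs h
  · refine Set.Subset.antisymm ?_ fun i hi => ⟨i, hi, .refl i⟩
    rintro i ⟨s, hs, h⟩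
    exact G.induce_reachable_mem _ hs h

/-- The minimal UC-territory is the least UC-territory. -/
theorem muct_isLeast (G : CausalDiagram V) (Y : V) :
    IsLeast {T | G.IsUCTerritory Y T} (G.muct Y) := by
  refine ⟨⟨?_, ?_, ?_, ?_⟩, fun T hT => Set.sInter_subset_of_mem hT⟩
  · exact Set.sInter_subset_of_mem (G.isUCTerritory_an Y)
  · exact fun T hT => hT.2.1
  · refine Set.Subset.antisymm ?_ fun i hi => ⟨i, hi, .refl⟩
    rintro i ⟨s, hs, h⟩ T hT
    rw [← hT.2.2.1]
    exact ⟨s, hs T hT, h⟩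
  · refine Set.Subset.antisymm ?_ fun i hi => ⟨i, hi, .refl i⟩
    rintro i ⟨s, hs, h⟩ T hT
    rw [← hT.2.2.2]
    exact ⟨s, hs T hT, h⟩

theorem wf [Finite V] (G : CausalDiagram V) : WellFounded G.dir := by
  have : Std.Irrefl (Relation.TransGen G.dir) := ⟨G.acyclic⟩
  exact Subrelation.wf (fun h => Relation.TransGen.single h)
    (Finite.wellFounded_of_trans_of_irrefl (Relation.TransGen G.dir))

end CausalDiagram

/-- What is shared by all models that are compared with each other: finite domains of the
endogenous variables, the numerical value of the reward variable `Y`, the exogenous variables with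
the spaces they take values in, and the exogenous arguments `scope i` of each structural function.
Two variables may share an exogenous variable only if `G` has a bidirected edge between them. -/
structure Frame {V : Type*} (G : CausalDiagram V) (Y : V) where
  dom : V → Type
  fintypeDom : ∀ i, Fintype (dom i)
  nonemptyDom : ∀ i, Nonempty (dom i)
  reward : dom Y → ℝ
  Exo : Type
  fintypeExo : Fintype Exo
  noise : Exo → Type
  measurableSpaceNoise : ∀ u, MeasurableSpace (noise u)
  scope : V → Set Exo
  confounded : ∀ i j, i ≠ j → (scope i ∩ scope j).Nonempty → G.bi.Adj i j

attribute [instance] Frame.fintypeDom Frame.nonemptyDom Frame.fintypeExo Frame.measurableSpaceNoise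

namespace Frame

variable {V : Type*} {G : CausalDiagram V} {Y : V}

/-- Joint values of all endogenous variables. -/
abbrev Assignment (F : Frame G Y) : Type _ := ∀ i, F.dom i

open Classical in
instance [Fintype V] (F : Frame G Y) : Fintype F.Assignment := Pi.instFintype

open Classical in
/-- `∑_a g(a, v ∖ a)`: sum over the values of the variables in `A`, the others being as in `v`. -/
def sumOver [Fintype V] (F : Frame G Y) (A : Set V) (v : F.Assignment) (g : F.Assignment → ℝ) : ℝ :=
  ∑ w : F.Assignment with ∀ i, i ∉ A → w i = v i, g w

end Frame

/-- A structural causal model that conforms to `G`: the function of a variable `i` takes the parents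
of `i` in `G` and the exogenous variables in `scope i`; exogenous variables are independent. -/
structure SCM {V : Type*} {G : CausalDiagram V} {Y : V} (F : Frame G Y) where
  f : ∀ i, (∀ j : {j // G.dir j i}, F.dom j) → (∀ u : F.scope i, F.noise u) → F.dom i
  measurable_f : ∀ i pa, @Measurable _ _ _ ⊤ (f i pa)
  law : ∀ u, Measure (F.noise u)
  isProbabilityMeasure_law : ∀ u, IsProbabilityMeasure (law u)

attribute [instance] SCM.isProbabilityMeasure_law

namespace SCM

variable {V : Type*} [Fintype V] {G : CausalDiagram V} {Y : V} {F : Frame G Y}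

open Classical in
/-- The values of the endogenous variables under `do(X = v[X])` for the unit `e`. -/
def solve (M : SCM F) (X : Set V) (v : F.Assignment) (e : ∀ u, F.noise u) : F.Assignment :=
  G.wf.fix fun i rec => if i ∈ X then v i else M.f i (fun j => rec j.1 j.2) (fun u => e u)

open Classical in
theorem solve_eq (M : SCM F) (X : Set V) (v : F.Assignment) (e : ∀ u, F.noise u) (i : V) :
    M.solve X v e i =
      if i ∈ X then v i else M.f i (fun j => M.solve X v e j) (fun u => e u) := by
  unfold solve
  rw [WellFounded.fix_eq]

/-- The distribution `P(U)`. -/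
def prior (M : SCM F) : Measure (∀ u, F.noise u) := Measure.pi M.law

/-- `E[Y]` under `do(X = v[X])`. -/
def expReward (M : SCM F) (X : Set V) (v : F.Assignment) : ℝ :=
  ∫ e, F.reward (M.solve X v e Y) ∂M.prior

/-- The maximal expected reward over all actions `do(X = x)`. -/
def best (M : SCM F) (X : Set V) : ℝ := ⨆ v : F.Assignment, M.expReward X v

/-- The c-factor `Q[C](v) = P_{v ∖ c}(c)`. -/
def Q (M : SCM F) (C : Set V) (v : F.Assignment) : ℝ :=
  M.prior.real {e | ∀ i ∈ C, M.solve Cᶜ v e i = v i}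

end SCM

namespace CausalDiagram

variable {V : Type*} [Fintype V]

/-- `X` and `W` are equivalent in terms of expected reward: in every model that conforms to `G`, the
actions that `v` prescribes on `X` and on `W` have the same expected reward. -/
def RewardEquiv (G : CausalDiagram V) (Y : V) (X W : Set V) : Prop :=
  ∀ (F : Frame G Y) (M : SCM F) (v : F.Assignment), M.expReward X v = M.expReward W v

/-- Minimal intervention set. -/
def IsMIS (G : CausalDiagram V) (Y : V) (X : Set V) : Prop :=
  Y ∉ X ∧ ∀ X' : Set V, X' ⊂ X → ¬ G.RewardEquiv Y X' X

/-- Possibly-optimal minimal intervention set. -/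
def IsPOMIS (G : CausalDiagram V) (Y : V) (X : Set V) : Prop :=
  G.IsMIS Y X ∧ ∃ (F : Frame G Y) (M : SCM F),
    ∀ W : Set V, G.IsMIS Y W → W ≠ X → M.best W < M.best X

/-- Possibly-optimal intervention set: some model makes `X` strictly better than every intervention
set that is not equivalent to it. -/
def IsPOIS (G : CausalDiagram V) (Y : V) (X : Set V) : Prop :=
  Y ∉ X ∧ ∃ (F : Frame G Y) (M : SCM F),
    ∀ W : Set V, Y ∉ W → ¬ G.RewardEquiv Y W X → M.best W < M.best X

/-- `Q[C]` is computable from `Q[D]` by repeatedly passing to ancestral sets and to c-components. -/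
inductive Computable (G : CausalDiagram V) (D : Set V) : Set V → Prop
  | self : Computable G D D
  | ancestral {A C : Set V} :
      Computable G D A → C ⊆ A → (G.induce A).An C = C → Computable G D C
  | component {A C : Set V} : Computable G D A → C ∈ G.components A → Computable G D C

/-- The variables `Y⁺` that matter for the reward under an intervention on `X`. -/
def yPlus (G : CausalDiagram V) (Y : V) (X : Set V) : Set V := (G.cutOut X).An {Y}

end CausalDiagram

/-- A target environment and `n` source environments that induce the collective selection diagram
given by `G` and the discrepancy sets `Δ 0, …, Δ (n - 1)`: the mechanism of a variable outside `Δ i`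
(its function and the distribution of its exogenous arguments) is the same in source `i` and in the
target. -/
structure Environments {V : Type*} {G : CausalDiagram V} {Y : V} (F : Frame G Y) {n : ℕ}
    (Δ : Fin n → Set V) where
  target : SCM F
  source : Fin n → SCM F
  agree : ∀ i, ∀ j ∉ Δ i,
    (source i).f j = target.f j ∧ ∀ u ∈ F.scope j, (source i).law u = target.law u

namespace SCM

variable {V : Type*} [Fintype V] {G : CausalDiagram V} {Y : V} {F : Frame G Y}

open Classical in
/-- Lower bound for the target c-factor of `C` through the source c-factor of `C' ⊇ C`. -/
def lowerFactor (M : SCM F) (C C' : Set V) (v : F.Assignment) : ℝ :=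
  if (G.induce C').An C = C then F.sumOver (C' \ C) v (M.Q C') else M.Q C' v

open Classical in
/-- Upper bound for the target c-factor of `C` through the source c-factor of `C' ⊇ C`. -/
def upperFactor (M : SCM F) (C C' : Set V) (v : F.Assignment) : ℝ :=
  if (G.induce C').An C = C then F.sumOver (C' \ C) v (M.Q C')
  else M.Q C' v + 1 - F.sumOver C v (M.Q C')

end SCM

namespace Environments

variable {V : Type*} [Fintype V] {G : CausalDiagram V} {Y : V} {F : Frame G Y} {n : ℕ}
  {Δ : Fin n → Set V}

/-- `σ` assigns to every c-component `C` of `G[Y⁺]` a source `i` and a set `C' ⊇ C`. It is admissible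
if `C` has no discrepancy in source `i` and the c-factor of `C'` in source `i` is computable from one
of the experiments `Z ∈ Zs i` conducted there, that is, from `Q[V ∖ Z] = P_z`. -/
def Admissible (_E : Environments F Δ) (Zs : Fin n → Set (Set V)) (X : Set V)
    (σ : Set V → Fin n × Set V) : Prop :=
  ∀ C ∈ G.components (G.yPlus Y X),
    C ⊆ (σ C).2 ∧ Disjoint C (Δ (σ C).1) ∧ ∃ Z ∈ Zs (σ C).1, G.Computable Zᶜ (σ C).2

open Classical in
/-- The expression `∑_{y⁺} y ∏_q (lower bound for Q*[C_q])`. Variables outside `Y⁺` have their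
values in `v`. -/
def lowerExpr (E : Environments F Δ) (X : Set V) (σ : Set V → Fin n × Set V)
    (v : F.Assignment) : ℝ :=
  F.sumOver (G.yPlus Y X) v fun w =>
    F.reward (w Y) * ∏ C : Set V with C ∈ G.components (G.yPlus Y X),
      (E.source (σ C).1).lowerFactor C (σ C).2 w

open Classical in
/-- The expression `∑_y y min{1, ∑_{y⁺ ∖ y} ∏_q (upper bound for Q*[C_q])}`. Variables outside `Y⁺`
have their values in `v`. -/
def upperExpr (E : Environments F Δ) (X : Set V) (σ : Set V → Fin n × Set V)
    (v : F.Assignment) : ℝ :=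
  ∑ y : F.dom Y, F.reward y *
    min 1 (∑ w : F.Assignment with (∀ i, i ∉ G.yPlus Y X → w i = v i) ∧ w Y = y,
      ∏ C : Set V with C ∈ G.components (G.yPlus Y X),
        (E.source (σ C).1).upperFactor C (σ C).2 w)

/-- The lower causal bound as an expression in `v`: the largest of `0` and all lower expressions. -/
def lowerBoundAt (E : Environments F Δ) (Zs : Fin n → Set (Set V)) (X : Set V)
    (v : F.Assignment) : EReal :=
  0 ⊔ ⨆ (σ : Set V → Fin n × Set V) (_ : E.Admissible Zs X σ), (E.lowerExpr X σ v : EReal)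

/-- The upper causal bound as an expression in `v`: the least of all upper expressions, and `∞` if
there is none. -/
def upperBoundAt (E : Environments F Δ) (Zs : Fin n → Set (Set V)) (X : Set V)
    (v : F.Assignment) : EReal :=
  ⨅ (σ : Set V → Fin n × Set V) (_ : E.Admissible Zs X σ), (E.upperExpr X σ v : EReal)

/-- The variables outside `Y⁺` on which the reward can depend under an intervention on `X`. They lie
in `X`, see `relevant_subset`. -/
def relevant (_E : Environments F Δ) (X : Set V) : Set V :=
  G.Pa (G.yPlus Y X) \ G.yPlus Y X

theorem relevant_subset (E : Environments F Δ) (X : Set V) : E.relevant X ⊆ X := by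
  rintro i ⟨⟨s, ⟨t, ht, hst⟩, hi⟩, hn⟩
  by_contra hX
  exact hn ⟨t, ht, .head ⟨hi, hX⟩ hst⟩

/-- The lower causal bound of the action `do(X = v[X])`, a function of `v[X]` alone: the expressions
are valid for all values of the variables outside `Y⁺` that cannot affect the reward, and the best
of these values is taken. -/
def lowerBound (E : Environments F Δ) (Zs : Fin n → Set (Set V)) (X : Set V)
    (v : F.Assignment) : EReal :=
  ⨆ (w : F.Assignment) (_ : ∀ i ∈ E.relevant X, w i = v i), E.lowerBoundAt Zs X w

/-- The upper causal bound of the action `do(X = v[X])`, see `lowerBound`. -/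
def upperBound (E : Environments F Δ) (Zs : Fin n → Set (Set V)) (X : Set V)
    (v : F.Assignment) : EReal :=
  ⨅ (w : F.Assignment) (_ : ∀ i ∈ E.relevant X, w i = v i), E.upperBoundAt Zs X w

end Environments

end

open Relation

noncomputable section

/-! ### Solutions of a model and resampling of independent noise. -/

namespace SCM

variable {V : Type*} [Fintype V] {G : CausalDiagram V} {Y : V} {F : Frame G Y}

/-! Let `T` be the minimal UC-territory of `G` without the edges into `R`; its border is `R†`.
Closure of `T` under bidirected edges means that the noise driving `T` is independent of the noise
that determines the border under `do(R)`. The expected reward of an action on `R` is therefore an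
average of expected rewards of actions on `R†`, so in every model `R†` does at least as well as `R`
(`expReward_le_best_ib`). The model witnessing that `R` is a POIS would contradict this if `R†` were
not equivalent to `R` (`IsPOIS.rewardEquiv_ib`).

The rest follows from equivalence. A deterministic model computing disjunctions shows that the
members of `X` reaching `Y` outside `X` form an invariant of the equivalence class
(`RewardEquiv.mem_iff`). An MIS equals this invariant part, so each class has at most one MIS, and
it lies in every set of the class. This gives `R† ⊆ R`, and lets the POIS witness serve as a POMIS
witness. The set `Y⁺` is also an invariant of the class (`RewardEquiv.yPlus_eq`), and the causal
bounds depend on `X` only through `Y⁺`. -/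

theorem solve_of_mem (M : SCM F) {X : Set V} (v : F.Assignment) (e : ∀ u, F.noise u) {i : V}
    (hi : i ∈ X) : M.solve X v e i = v i := by
  rw [solve_eq, if_pos hi]

theorem solve_of_notMem (M : SCM F) {X : Set V} (v : F.Assignment) (e : ∀ u, F.noise u) {i : V}
    (hi : i ∉ X) :
    M.solve X v e i = M.f i (fun j => M.solve X v e j) (fun u => e u) := by
  rw [solve_eq, if_neg hi]

/-- Two solutions agree on a set `A` if each member of `A` either has the same value in both, or is
determined in both by the same exogenous values and by parents in `A`. -/
theorem solve_congr (M : SCM F) {X X' : Set V} {v v' : F.Assignment} {e e' : ∀ u, F.noise u}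
    {A : Set V}
    (h : ∀ i ∈ A, M.solve X v e i = M.solve X' v' e' i ∨
      (i ∉ X ∧ i ∉ X' ∧ (∀ j, G.dir j i → j ∈ A) ∧ ∀ u ∈ F.scope i, e u = e' u)) :
    ∀ i ∈ A, M.solve X v e i = M.solve X' v' e' i := by
  intro i
  induction i using G.wf.induction with
  | _ i ih =>
    intro hi
    rcases h i hi with h | ⟨h₁, h₂, h₃, h₄⟩
    · exact h
    · rw [M.solve_of_notMem v e h₁, M.solve_of_notMem v' e' h₂]
      congr 1
      · funext j
        exact ih j j.2 (h₃ j j.2)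
      · funext u
        exact h₄ u u.2

/-- Each structural function is measurable in the noise only for fixed parent values. Since domains
are finite, splitting over the finitely many parent values suffices. -/
theorem measurable_solve (M : SCM F) (X : Set V) (v : F.Assignment) (i : V) :
    @Measurable _ _ _ ⊤ (fun e => M.solve X v e i) := by
  induction i using G.wf.induction with
  | _ i ih =>
    by_cases hi : i ∈ X
    · simp only [M.solve_of_mem v _ hi]
      exact @measurable_const _ _ ⊤ _ _
    · simp only [M.solve_of_notMem v _ hi]
      intro s _
      have key : (fun e : ∀ u, F.noise u =>
          M.f i (fun j => M.solve X v e j) (fun u => e u)) ⁻¹' s =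
          ⋃ pa : ∀ j : {j // G.dir j i}, F.dom j,
            (⋂ j : {j // G.dir j i}, (fun e => M.solve X v e j) ⁻¹' {pa j}) ∩
              (fun e (u : F.scope i) => e u) ⁻¹' (M.f i pa ⁻¹' s) := by
        ext e
        simp only [Set.mem_preimage, Set.mem_iUnion, Set.mem_inter_iff, Set.mem_iInter,
          Set.mem_singleton_iff]
        constructor
        · exact fun h => ⟨fun j => M.solve X v e j, fun _ => rfl, h⟩
        · rintro ⟨pa, hpa, h⟩
          obtain rfl : (fun j : {j // G.dir j i} => M.solve X v e j) = pa := funext hpa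
          exact h
      rw [key]
      refine MeasurableSet.iUnion fun pa => MeasurableSet.inter
        (MeasurableSet.iInter fun j => ih j j.2 trivial) ?_
      have hm : Measurable (fun (e : ∀ u, F.noise u) (u : F.scope i) => e u) := by fun_prop
      exact hm (M.measurable_f i pa trivial)

instance (M : SCM F) : IsProbabilityMeasure M.prior := by
  unfold prior; infer_instance

theorem integrable_reward (M : SCM F) (X : Set V) (v : F.Assignment) :
    Integrable (fun e => F.reward (M.solve X v e Y)) M.prior := by
  obtain ⟨C, hC⟩ := (Set.finite_range fun y => ‖F.reward y‖).bddAbove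
  refine Integrable.of_bound (C := C) ?_ (ae_of_all _ fun e => hC ⟨_, rfl⟩)
  have h : Measurable (fun e => F.reward (M.solve X v e Y)) :=
    fun s _ => M.measurable_solve X v Y (show MeasurableSet[⊤] (F.reward ⁻¹' s) from trivial)
  exact h.aestronglyMeasurable

theorem expReward_eq_of_forall (M : SCM F) {X : Set V} {v : F.Assignment} {c : ℝ}
    (h : ∀ e, F.reward (M.solve X v e Y) = c) : M.expReward X v = c := by
  simp [expReward, h]

theorem expReward_le_best (M : SCM F) (X : Set V) (v : F.Assignment) :
    M.expReward X v ≤ M.best X :=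
  le_ciSup (Set.finite_range _).bddAbove v

omit [Fintype V] in
open Classical in
/-- Drawing the exogenous variables in `S` and those outside `S` from two independent copies of the
prior yields the prior. -/
theorem measurePreserving_piecewise (M : SCM F) (S : Set F.Exo) :
    MeasurePreserving (fun p : (∀ u, F.noise u) × (∀ u, F.noise u) => S.piecewise p.2 p.1)
      (M.prior.prod M.prior) M.prior := by
  have hm : Measurable
      (fun p : (∀ u, F.noise u) × (∀ u, F.noise u) => S.piecewise p.2 p.1) := by
    refine measurable_pi_lambda _ fun u => ?_
    by_cases hu : u ∈ S
    · simp only [Set.piecewise_eq_of_mem _ _ _ hu]; fun_prop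
    · simp only [Set.piecewise_eq_of_notMem _ _ _ hu]; fun_prop
  refine ⟨hm, (Measure.pi_eq fun s hs => ?_).symm⟩
  rw [Measure.map_apply hm (MeasurableSet.univ_pi hs)]
  -- The two copies are constrained on complementary coordinates, so the preimage of a box is a
  -- product of two boxes.
  have key : (fun p : (∀ u, F.noise u) × (∀ u, F.noise u) => S.piecewise p.2 p.1) ⁻¹'
      Set.univ.pi s =
      (Set.univ.pi fun u => if u ∈ S then Set.univ else s u) ×ˢ
        (Set.univ.pi fun u => if u ∈ S then s u else Set.univ) := by
    ext p
    simp only [Set.mem_preimage, Set.mem_univ_pi, Set.mem_prod, ← forall_and]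
    refine forall_congr' fun u => ?_
    by_cases hu : u ∈ S <;> simp [hu]
  rw [key, Measure.prod_prod, prior, Measure.pi_pi, Measure.pi_pi, ← Finset.prod_mul_distrib]
  refine Finset.prod_congr rfl fun u _ => ?_
  by_cases hu : u ∈ S <;> simp [hu]

/-- If the reward under `do(X = v[X])` is obtained from an intervention on `W` whose values are
determined by the exogenous variables outside `S`, while the intervened system uses only those in
`S`, then some action on `W` is at least as good. -/
theorem expReward_le_best_of_split (M : SCM F) (X W : Set V) (v : F.Assignment) (S : Set F.Exo)
    (h : ∀ e₁ e₂ e : ∀ u, F.noise u, (∀ u ∈ S, e u = e₂ u) → (∀ u ∉ S, e u = e₁ u) →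
      M.solve X v e Y = M.solve W (M.solve X v e₁) e₂ Y) :
    M.expReward X v ≤ M.best W := by
  classical
  have hmp := M.measurePreserving_piecewise S
  have hint := M.integrable_reward X v
  have hsplit : ∀ p : (∀ u, F.noise u) × (∀ u, F.noise u),
      F.reward (M.solve X v (S.piecewise p.2 p.1) Y) =
        F.reward (M.solve W (M.solve X v p.1) p.2 Y) := fun p => by
    rw [h p.1 p.2 _ (fun u hu => Set.piecewise_eq_of_mem _ _ _ hu)
      (fun u hu => Set.piecewise_eq_of_notMem _ _ _ hu)]
  have hint' : Integrable (fun p : (∀ u, F.noise u) × (∀ u, F.noise u) =>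
      F.reward (M.solve W (M.solve X v p.1) p.2 Y)) (M.prior.prod M.prior) := by
    simp only [← hsplit]
    exact hmp.integrable_comp_of_integrable hint
  calc M.expReward X v
      = ∫ p, F.reward (M.solve X v (S.piecewise p.2 p.1) Y) ∂(M.prior.prod M.prior) := by
        rw [expReward, ← hmp.map_eq, integral_map hmp.aemeasurable
          (by rw [hmp.map_eq]; exact hint.aestronglyMeasurable), hmp.map_eq]
    -- For fixed `e₁` the inner integral over `e₂` is the expected reward of one action on `W`.
    _ = ∫ e₁, M.expReward W (M.solve X v e₁) ∂M.prior := by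
        simp only [hsplit]
        rw [integral_prod _ hint']
        rfl
    _ ≤ ∫ _, M.best W ∂M.prior :=
        integral_mono hint'.integral_prod_left (integrable_const _)
          fun e₁ => M.expReward_le_best W _
    _ = M.best W := by simp

end SCM

/-! ### Minimal UC-territories, borders and `Y⁺`. -/

namespace CausalDiagram

variable {V : Type*}

theorem mem_muct (G : CausalDiagram V) (Y : V) : Y ∈ G.muct Y :=
  (G.muct_isLeast Y).1.2.1

theorem muct_subset_an (G : CausalDiagram V) (Y : V) : G.muct Y ⊆ G.An {Y} :=
  (G.muct_isLeast Y).1.1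

theorem mem_an_of_dir (G : CausalDiagram V) {A : Set V} {i j : V} (h : G.dir i j)
    (hj : j ∈ G.An A) : i ∈ G.An A := by
  obtain ⟨s, hs, h'⟩ := hj
  exact ⟨s, hs, .head h h'⟩

theorem muct_of_dir (G : CausalDiagram V) {Y i j : V} (hi : i ∈ G.muct Y) (h : G.dir i j)
    (hj : j ∈ G.An {Y}) : j ∈ G.muct Y := by
  rw [← (G.muct_isLeast Y).1.2.2.1]
  exact ⟨i, hi, .single ⟨h, G.muct_subset_an Y hi, hj⟩⟩

theorem muct_of_bi (G : CausalDiagram V) {Y i j : V} (hi : i ∈ G.muct Y) (h : G.bi.Adj i j)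
    (hj : j ∈ G.An {Y}) : j ∈ G.muct Y := by
  rw [← (G.muct_isLeast Y).1.2.2.2]
  refine ⟨i, hi, SimpleGraph.Adj.reachable ?_⟩
  exact ⟨h, G.muct_subset_an Y hi, hj⟩

theorem ib_subset_an (G : CausalDiagram V) (Y : V) : G.ib Y ⊆ G.An {Y} := by
  rintro i ⟨⟨t, ht, h⟩, -⟩
  exact G.mem_an_of_dir h (G.muct_subset_an Y ht)

/-- The minimal UC-territory of `G` without the edges into `X` does not meet `X`. -/
theorem notMem_of_mem_muct_cutIn (G : CausalDiagram V) {Y : V} {X : Set V} (hY : Y ∉ X) {i : V}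
    (hi : i ∈ (G.cutIn X).muct Y) : i ∉ X := by
  -- Deleting `X` keeps the closure properties: no remaining edge enters `X`, so no path starting
  -- outside `X` can end in it. Minimality then applies.
  have h : (G.cutIn X).IsUCTerritory Y ((G.cutIn X).muct Y \ X) := by
    obtain ⟨h₁, h₂, h₃, h₄⟩ := ((G.cutIn X).muct_isLeast Y).1
    refine ⟨Set.sdiff_subset.trans h₁, ⟨h₂, hY⟩, ?_, ?_⟩
    · refine Set.Subset.antisymm ?_ fun i hi => ⟨i, hi, .refl⟩
      rintro i ⟨s, hs, h⟩
      refine ⟨h₃ ▸ ⟨s, hs.1, h⟩, ?_⟩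
      rcases h.cases_tail with rfl | ⟨b, -, hb⟩
      · exact hs.2
      · exact hb.1.2
    · refine Set.Subset.antisymm ?_ fun i hi => ⟨i, hi, .refl i⟩
      rintro i ⟨s, hs, h⟩
      refine ⟨h₄ ▸ ⟨s, hs.1, h⟩, ?_⟩
      rw [SimpleGraph.reachable_iff_reflTransGen] at h
      rcases h.cases_tail with rfl | ⟨b, -, hb⟩
      · exact hs.2
      · exact hb.1.2.2
  exact (((G.cutIn X).muct_isLeast Y).2 h hi).2

/-- Every member of the interventional border of `G` without the edges into `X` reaches `Y` without
passing through the border again. -/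
theorem ib_cutIn_subset_an (G : CausalDiagram V) (Y : V) (X : Set V) :
    (G.cutIn X).ib Y ⊆ (G.cutIn ((G.cutIn X).ib Y)).An {Y} := by
  -- A path to `Y` from the territory stays inside it, hence avoids the border and survives the cut.
  have hT : ∀ t ∈ (G.cutIn X).muct Y, t ∈ (G.cutIn ((G.cutIn X).ib Y)).An {Y} := by
    intro t ht
    obtain ⟨_, rfl, h⟩ := (G.cutIn X).muct_subset_an Y ht
    induction h using ReflTransGen.head_induction_on with
    | refl => exact ⟨_, rfl, .refl⟩
    | head hab hb ih =>
      have hbT := (G.cutIn X).muct_of_dir ht hab ⟨_, rfl, hb⟩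
      exact mem_an_of_dir _ ⟨hab.1, fun hib => hib.2 hbT⟩ (ih hbT)
  rintro i ⟨⟨t, ht, hit⟩, -⟩
  exact mem_an_of_dir _ ⟨hit.1, fun hib => hib.2 ht⟩ (hT t ht)

/-- Every vertex of such a path except `Y` is left by an edge, and `Y ∉ X`; so the path avoids `X`
altogether. -/
theorem mem_yPlus_imp (G : CausalDiagram V) {Y : V} {X : Set V} (hY : Y ∉ X) {i : V}
    (hi : i ∈ G.yPlus Y X) : i ∉ X ∧ i ∈ (G.cutIn X).An {Y} := by
  obtain ⟨_, rfl, h⟩ := hi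
  induction h using ReflTransGen.head_induction_on with
  | refl => exact ⟨hY, _, rfl, .refl⟩
  | head hac _ ih => exact ⟨hac.2, mem_an_of_dir _ ⟨hac.1, ih.1⟩ ih.2⟩

/-! ### Disjunctive models and invariants of equivalence. -/

/-- Frame with Boolean variables and no exogenous variables; the reward is one if `Y` is true. -/
abbrev boolFrame (G : CausalDiagram V) (Y : V) : Frame G Y where
  dom _ := Bool
  fintypeDom _ := inferInstance
  nonemptyDom _ := inferInstance
  reward b := if b then 1 else 0
  Exo := Empty
  fintypeExo := inferInstance
  noise _ := Unit
  measurableSpaceNoise _ := inferInstance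
  scope _ := ∅
  confounded := by simp

open Classical in
/-- The deterministic model in which a variable is true if one of its parents is. -/
def orModel (G : CausalDiagram V) (Y : V) : SCM (G.boolFrame Y) where
  f _ pa _ := decide (∃ j, pa j = true)
  measurable_f _ _ := @measurable_const _ _ ⊤ _ _
  law u := u.elim
  isProbabilityMeasure_law u := u.elim

variable [Fintype V]

open Classical in
/-- The assignment in which only `z` is true. -/
def indicator (G : CausalDiagram V) (Y z : V) : (G.boolFrame Y).Assignment :=
  fun j => decide (j = z)

open Classical in
/-- Under `do(X)` with only `z` set to true, a variable of the disjunctive model is true exactly if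
`z` belongs to `X` and reaches it outside `X`. -/
theorem orModel_solve (G : CausalDiagram V) (Y : V) (X : Set V) (z : V) (e) (i : V) :
    (G.orModel Y).solve X (G.indicator Y z) e i = true ↔
      z ∈ X ∧ ReflTransGen (G.cutIn X).dir z i := by
  induction i using G.wf.induction with
  | _ i ih =>
    by_cases hi : i ∈ X
    · rw [SCM.solve_of_mem _ _ _ hi]
      refine decide_eq_true_iff.trans ⟨?_, ?_⟩
      · rintro rfl
        exact ⟨hi, .refl⟩
      · rintro ⟨-, h⟩
        rcases h.cases_tail with h | ⟨b, -, hb⟩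
        · exact h
        · exact absurd hi hb.2
    · rw [SCM.solve_of_notMem _ _ _ hi]
      refine (@decide_eq_true_iff _ (_)).trans ⟨?_, ?_⟩
      · rintro ⟨⟨j, hj⟩, h⟩
        obtain ⟨hz, h⟩ := (ih j hj).1 h
        exact ⟨hz, h.tail ⟨hj, hi⟩⟩
      · rintro ⟨hz, h⟩
        rcases h.cases_tail with rfl | ⟨b, hb, hbi⟩
        · exact absurd hz hi
        · exact ⟨⟨b, hbi.1⟩, (ih b hbi.1).2 ⟨hz, hb⟩⟩

open Classical in
theorem orModel_expReward (G : CausalDiagram V) (Y : V) (X : Set V) (z : V) :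
    (G.orModel Y).expReward X (G.indicator Y z) =
      if z ∈ X ∧ z ∈ (G.cutIn X).An {Y} then 1 else 0 := by
  have h : ∀ e, (G.boolFrame Y).reward ((G.orModel Y).solve X (G.indicator Y z) e Y) =
      if z ∈ X ∧ z ∈ (G.cutIn X).An {Y} then 1 else 0 := by
    intro e
    have := G.orModel_solve Y X z e Y
    simp only [An, Set.mem_ofPred_eq, Set.mem_singleton_iff, exists_eq_left, ← this]
  exact SCM.expReward_eq_of_forall _ h

theorem RewardEquiv.symm {G : CausalDiagram V} {Y : V} {X W : Set V} (h : G.RewardEquiv Y X W) :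
    G.RewardEquiv Y W X := fun F M v => (h F M v).symm

theorem RewardEquiv.trans {G : CausalDiagram V} {Y : V} {X W Z : Set V} (h : G.RewardEquiv Y X W)
    (h' : G.RewardEquiv Y W Z) : G.RewardEquiv Y X Z := fun F M v => (h F M v).trans (h' F M v)

/-- Both sides are read off from the disjunctive model with only `z` set to true, where the expected
reward is 1 or 0. -/
theorem RewardEquiv.mem_iff {G : CausalDiagram V} {Y : V} {X W : Set V} (h : G.RewardEquiv Y X W)
    (z : V) : (z ∈ X ∧ z ∈ (G.cutIn X).An {Y}) ↔ (z ∈ W ∧ z ∈ (G.cutIn W).An {Y}) := by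
  classical
  have := h _ (G.orModel Y) (G.indicator Y z)
  rw [orModel_expReward, orModel_expReward] at this
  split_ifs at this with h₁ h₂ h₂
  · exact iff_of_true h₁ h₂
  · exact absurd this one_ne_zero
  · exact absurd this zero_ne_one
  · exact iff_of_false h₁ h₂

/-- An intervention set without superfluous members is contained in every equivalent one. -/
theorem RewardEquiv.inter_an_subset {G : CausalDiagram V} {Y : V} {X W : Set V}
    (h : G.RewardEquiv Y X W) : X ∩ (G.cutIn X).An {Y} ⊆ W :=
  fun z hz => ((h.mem_iff z).1 hz).1

/-- The members of `X` that cannot reach the reward outside `X` are superfluous. -/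
theorem rewardEquiv_inter_an (G : CausalDiagram V) (Y : V) (X : Set V) :
    G.RewardEquiv Y (X ∩ (G.cutIn X).An {Y}) X := by
  intro F M v
  unfold SCM.expReward
  congr 1
  funext e
  congr 1
  refine M.solve_congr (A := (G.cutIn X).An {Y}) (fun i hi => ?_) Y ⟨Y, rfl, .refl⟩
  by_cases hX : i ∈ X
  · have hXi : i ∈ X ∩ (G.cutIn X).An {Y} := ⟨hX, hi⟩
    exact .inl (by rw [M.solve_of_mem v e hXi, M.solve_of_mem v e hX])
  · exact .inr ⟨fun h => hX h.1, hX, fun j hj => mem_an_of_dir _ ⟨hj, hX⟩ hi, fun _ _ => rfl⟩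

theorem isMIS_iff (G : CausalDiagram V) (Y : V) (X : Set V) :
    G.IsMIS Y X ↔ Y ∉ X ∧ X ⊆ (G.cutIn X).An {Y} := by
  refine and_congr_right fun _ => ⟨fun h => ?_, fun h X' hX' he => ?_⟩
  · by_contra hX
    refine h _ ⟨Set.inter_subset_left, fun h' => hX fun i hi => (h' hi).2⟩
      (G.rewardEquiv_inter_an Y X)
  · exact hX'.2 fun z hz => he.symm.inter_an_subset ⟨hz, h hz⟩

theorem IsMIS.eq_of_rewardEquiv {G : CausalDiagram V} {Y : V} {X W : Set V} (hX : G.IsMIS Y X)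
    (hW : G.IsMIS Y W) (h : G.RewardEquiv Y X W) : X = W := by
  rw [isMIS_iff] at hX hW
  exact Set.Subset.antisymm (fun z hz => h.inter_an_subset ⟨hz, hX.2 hz⟩)
    fun z hz => h.symm.inter_an_subset ⟨hz, hW.2 hz⟩

/-! ### The border dominates the original intervention set. -/

theorem isMIS_ib_cutIn (G : CausalDiagram V) (Y : V) (X : Set V) :
    G.IsMIS Y ((G.cutIn X).ib Y) :=
  (G.isMIS_iff Y _).2 ⟨fun h => h.2 (mem_muct _ Y), G.ib_cutIn_subset_an Y X⟩

/-- In every model some action on the interventional border of `G` without the edges into `X` is at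
least as good as any action on `X`. -/
theorem expReward_le_best_ib (G : CausalDiagram V) {Y : V} {X : Set V} (hY : Y ∉ X)
    {F : Frame G Y} (M : SCM F) (v : F.Assignment) :
    M.expReward X v ≤ M.best ((G.cutIn X).ib Y) := by
  set H := G.cutIn X
  have hTX : ∀ i ∈ H.muct Y, i ∉ X := fun i hi => G.notMem_of_mem_muct_cutIn hY hi
  refine M.expReward_le_best_of_split X (H.ib Y) v {u | ∃ i ∈ H.muct Y, u ∈ F.scope i} ?_
  intro e₁ e₂ e h₂ h₁
  -- Outside the territory the system is autonomous: a parent in the territory, or noise shared with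
  -- it, would pull a non-intervened `i` into the territory.
  have hout : ∀ i ∈ H.An {Y} \ H.muct Y, M.solve X v e i = M.solve X v e₁ i := by
    refine M.solve_congr fun i hi => ?_
    by_cases hX : i ∈ X
    · exact .inl (by rw [M.solve_of_mem v _ hX, M.solve_of_mem v _ hX])
    · refine .inr ⟨hX, hX, fun j hj => ?_, fun u hu => h₁ u ?_⟩
      · have hji : H.dir j i := ⟨hj, hX⟩
        exact ⟨mem_an_of_dir _ hji hi.1, fun hjT => hi.2 (muct_of_dir _ hjT hji hi.1)⟩
      · rintro ⟨t, ht, hut⟩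
        have hti : t ≠ i := fun h => hi.2 (h ▸ ht)
        exact hi.2 (muct_of_bi _ ht ⟨F.confounded t i hti ⟨u, hut, hu⟩, hTX t ht, hX⟩ hi.1)
  -- Territory members use only noise in `S` and parents in the territory or border; on the border,
  -- `hout` matches the prescribed values.
  refine M.solve_congr (A := H.muct Y ∪ H.ib Y) (fun i hi => ?_) Y (.inl (mem_muct _ Y))
  rcases hi with hi | hi
  · refine .inr ⟨hTX i hi, fun h => h.2 hi, fun j hj => ?_, fun u hu => h₂ u ⟨i, hi, hu⟩⟩
    by_cases hjT : j ∈ H.muct Y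
    · exact .inl hjT
    · exact .inr ⟨⟨i, hi, hj, hTX i hi⟩, hjT⟩
  · refine .inl ?_
    rw [M.solve_of_mem _ _ hi]
    exact hout i ⟨H.ib_subset_an Y hi, hi.2⟩

theorem best_le_best_ib (G : CausalDiagram V) {Y : V} {X : Set V} (hY : Y ∉ X)
    {F : Frame G Y} (M : SCM F) : M.best X ≤ M.best ((G.cutIn X).ib Y) :=
  ciSup_le fun v => G.expReward_le_best_ib hY M v

theorem RewardEquiv.best_eq {G : CausalDiagram V} {Y : V} {X W : Set V}
    (h : G.RewardEquiv Y X W) {F : Frame G Y} (M : SCM F) : M.best X = M.best W :=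
  iSup_congr fun v => h F M v

theorem IsPOIS.rewardEquiv_ib {G : CausalDiagram V} {Y : V} {R : Set V} (hR : G.IsPOIS Y R) :
    G.RewardEquiv Y R ((G.cutIn R).ib Y) := by
  obtain ⟨hY, F, M, h⟩ := hR
  by_contra hne
  exact absurd (h _ (G.isMIS_ib_cutIn Y R).1 fun h' => hne h'.symm)
    (not_lt.2 (G.best_le_best_ib hY M))

/-! ### Invariance of `Y⁺` and of the causal bounds. -/

theorem RewardEquiv.yPlus_subset {G : CausalDiagram V} {Y : V} {X W : Set V}
    (h : G.RewardEquiv Y X W) (hX : Y ∉ X) : G.yPlus Y W ⊆ G.yPlus Y X := by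
  rintro i ⟨_, rfl, hi⟩
  induction hi using ReflTransGen.head_induction_on with
  | refl => exact ⟨_, rfl, .refl⟩
  | @head a c hac _ ih =>
    have hc := G.mem_yPlus_imp hX ih
    -- Otherwise `a` would be a member of `X` reaching `Y` outside `X`, hence a member of `W`, yet
    -- the path leaves `a` in the graph without edges out of `W`.
    have ha : a ∉ X := fun ha =>
      hac.2 (h.inter_an_subset ⟨ha, mem_an_of_dir _ ⟨hac.1, hc.1⟩ hc.2⟩)
    exact mem_an_of_dir _ ⟨hac.1, ha⟩ ih

theorem RewardEquiv.yPlus_eq {G : CausalDiagram V} {Y : V} {X W : Set V}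
    (h : G.RewardEquiv Y X W) (hX : Y ∉ X) (hW : Y ∉ W) : G.yPlus Y X = G.yPlus Y W :=
  (h.symm.yPlus_subset hW).antisymm (h.yPlus_subset hX)

end CausalDiagram

namespace Environments

variable {V : Type*} [Fintype V] {G : CausalDiagram V} {Y : V} {F : Frame G Y} {n : ℕ}
  {Δ : Fin n → Set V}

theorem lowerBoundAt_congr (E : Environments F Δ) (Zs : Fin n → Set (Set V)) {X W : Set V}
    (h : G.yPlus Y X = G.yPlus Y W) (v : F.Assignment) :
    E.lowerBoundAt Zs X v = E.lowerBoundAt Zs W v := by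
  unfold lowerBoundAt Admissible lowerExpr
  rw [h]

theorem upperBoundAt_congr (E : Environments F Δ) (Zs : Fin n → Set (Set V)) {X W : Set V}
    (h : G.yPlus Y X = G.yPlus Y W) (v : F.Assignment) :
    E.upperBoundAt Zs X v = E.upperBoundAt Zs W v := by
  unfold upperBoundAt Admissible upperExpr
  rw [h]

theorem lowerBound_congr (E : Environments F Δ) (Zs : Fin n → Set (Set V)) {X W : Set V}
    (h : G.yPlus Y X = G.yPlus Y W) (v : F.Assignment) :
    E.lowerBound Zs X v = E.lowerBound Zs W v := by
  unfold lowerBound relevant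
  simp only [E.lowerBoundAt_congr Zs h, h]

theorem upperBound_congr (E : Environments F Δ) (Zs : Fin n → Set (Set V)) {X W : Set V}
    (h : G.yPlus Y X = G.yPlus Y W) (v : F.Assignment) :
    E.upperBound Zs X v = E.upperBound Zs W v := by
  unfold upperBound relevant
  simp only [E.upperBoundAt_congr Zs h, h]

end Environments

end

theorem mainTheorem6 {V : Type*} [Fintype V] (G : CausalDiagram V) (Y : V) (R : Set V)
    (hR : G.IsPOIS Y R) :
    G.IsPOMIS Y ((G.cutIn R).ib Y) ∧
    (G.cutIn R).ib Y ⊆ R ∧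
    (∀ (F : Frame G Y) (M : SCM F) (v : F.Assignment),
      M.expReward R v = M.expReward ((G.cutIn R).ib Y) v) ∧
    (∀ (F : Frame G Y) (n : ℕ) (Δ : Fin n → Set V) (E : Environments F Δ)
      (Zs : Fin n → Set (Set V)) (v : F.Assignment),
      E.lowerBoundAt Zs R v = E.lowerBoundAt Zs ((G.cutIn R).ib Y) v ∧
      E.upperBoundAt Zs R v = E.upperBoundAt Zs ((G.cutIn R).ib Y) v ∧
      E.lowerBound Zs R v = E.lowerBound Zs ((G.cutIn R).ib Y) v ∧
      E.upperBound Zs R v = E.upperBound Zs ((G.cutIn R).ib Y) v) := by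
  have he := hR.rewardEquiv_ib
  have hmis := G.isMIS_ib_cutIn Y R
  have hsub : (G.cutIn R).ib Y ⊆ R := fun z hz =>
    he.symm.inter_an_subset ⟨hz, G.ib_cutIn_subset_an Y R hz⟩
  have hy := he.yPlus_eq hR.1 hmis.1
  refine ⟨⟨hmis, ?_⟩, hsub, he, fun F n Δ E Zs v => ⟨E.lowerBoundAt_congr Zs hy v,
    E.upperBoundAt_congr Zs hy v, E.lowerBound_congr Zs hy v, E.upperBound_congr Zs hy v⟩⟩
  obtain ⟨-, F, M, h⟩ := hR
  refine ⟨F, M, fun W hW hne => ?_⟩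
  rw [← he.best_eq M]
  -- An MIS equivalent to `R` is equivalent to the border and so equal to it; every other MIS is
  -- strictly beaten in the POIS model.
  exact h W hW.1 fun hWR => hne (hW.eq_of_rewardEquiv hmis (hWR.trans he))
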